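/- Let $m,n\ge 1$ be integers, let $2\le p<\infty$ and $1\le k\le \min\{m,n\}$. For a complex $m\times n$ matrix $B$ with singular values $\sigma_1(B)\ge\sigma_2(B)\ge\cdots\ge\sigma_{\min\{m,n\}}(B)\ge 0$, let $$\|B\|_{(p,k)}=\left(\sigma_1^p(B)+\sigma_2^p(B)+\cdots+\sigma_k^p(B)\right)^{1/p}$$ denote its Ky Fan $p$-$k$ norm. Let $A$ and $X$ be complex $m\times n$ matrices with $\operatorname{rank}(X)>n-k$. Then there is a unique $\alpha_0\in\mathbb{C}$ such that $$\|A-\alpha_0X\|_{(p,k)}=\min_{\alpha\in\mathbb{C}}\|A-\alpha X\|_{(p,k)}.$$ -/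

import Mathlib

/-- The `i`-th largest singular value (counted from `0`, with multiplicity) of a complex
`m × n` matrix, viewed as a linear map between the Euclidean spaces `ℂⁿ → ℂᵐ`. -/
noncomputable def matrixSingularValue {m n : ℕ} (A : Matrix (Fin m) (Fin n) ℂ) (i : ℕ) : ℝ :=
  (Matrix.toLpLin 2 2 A).singularValues i

/-- The Ky Fan `p`-`k` norm: the `ℓ_p` norm of the vector of the `k` largest singular values. -/
noncomputable def kyFanNorm {m n : ℕ} (p : ℝ) (k : ℕ) (A : Matrix (Fin m) (Fin n) ℂ) : ℝ :=
  (∑ i ∈ Finset.range k, matrixSingularValue A i ^ p) ^ (1 / p)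

/-! The idea is to view `α ↦ ∑ i < k, σᵢ(A - αX)ᵖ` as a pointwise maximum. Since `2 ≤ p`, Fan's
principle says that `∑ i < k, σᵢ(T)ᵖ` is the maximum of `∑ i, ‖T uᵢ‖ᵖ` over orthonormal families
`u₁, …, u_k`. The kernel of `X` has dimension less than `k`, so `X` does not kill any such family,
and hence each function `α ↦ ∑ i, ‖A uᵢ - α X uᵢ‖ᵖ` is strictly convex and coercive. Both properties
pass to the maximum, and a strictly convex coercive function on `ℂ` has exactly one minimizer. -/

open Filter Finset InnerProductSpace Module
open scoped ENNReal

section Convexity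

theorem strictConvexOn_of_forall_exists_le {V : Type*} [AddCommMonoid V] [Module ℝ V] {s : Set V}
    {f : V → ℝ} (hs : Convex ℝ s)
    (hf : ∀ z ∈ s, ∃ g : V → ℝ, StrictConvexOn ℝ s g ∧ (∀ x ∈ s, g x ≤ f x) ∧ g z = f z) :
    StrictConvexOn ℝ s f := by
  refine ⟨hs, fun x hx y hy hxy a b ha hb hab => ?_⟩
  obtain ⟨g, hg, hgf, hgz⟩ := hf (a • x + b • y) (hs hx hy ha.le hb.le hab)
  calc f (a • x + b • y) = g (a • x + b • y) := hgz.symm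
    _ < a • g x + b • g y := hg.2 hx hy hxy ha hb hab
    _ ≤ a • f x + b • f y := by gcongr; exacts [hgf x hx, hgf y hy]

theorem strictConvexOn_sum {ι V : Type*} [Fintype ι] [AddCommMonoid V] [Module ℝ V] {s : Set V}
    {f : ι → V → ℝ} (hf : ∀ i, ConvexOn ℝ s (f i)) (hf' : ∃ i, StrictConvexOn ℝ s (f i)) :
    StrictConvexOn ℝ s fun x => ∑ i, f i x := by
  obtain ⟨i₀, hi₀⟩ := hf'
  refine ⟨hi₀.1, fun x hx y hy hxy a b ha hb hab => ?_⟩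
  calc ∑ i, f i (a • x + b • y) < ∑ i, (a • f i x + b • f i y) :=
        sum_lt_sum (fun i _ => (hf i).2 hx hy ha.le hb.le hab)
          ⟨i₀, mem_univ i₀, hi₀.2 hx hy hxy ha hb hab⟩
    _ = a • ∑ i, f i x + b • ∑ i, f i y := by rw [sum_add_distrib, smul_sum, smul_sum]

theorem existsUnique_forall_le_of_strictConvexOn {V : Type*} [NormedAddCommGroup V]
    [NormedSpace ℝ V] [FiniteDimensional ℝ V] {f : V → ℝ} (hf : StrictConvexOn ℝ Set.univ f)
    (hlim : Tendsto f (cocompact V) atTop) : ∃! x, ∀ y, f x ≤ f y := by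
  have hcont : Continuous f := continuousOn_univ.mp (hf.convexOn.continuousOn isOpen_univ)
  obtain ⟨x, hx⟩ := hcont.exists_forall_le hlim
  exact ⟨x, hx, fun z hz =>
    hf.eq_of_isMinOn (fun y _ => hz y) (fun y _ => hx y) (Set.mem_univ z) (Set.mem_univ x)⟩

theorem strictConvexOn_norm_rpow {V : Type*} [NormedAddCommGroup V] [NormedSpace ℝ V]
    [StrictConvexSpace ℝ V] {p : ℝ} (hp : 1 < p) :
    StrictConvexOn ℝ Set.univ fun x : V => ‖x‖ ^ p := by
  have hp₀ : 0 < p := zero_lt_one.trans hp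
  refine ⟨convex_univ, fun x _ y _ hxy a b ha hb hab => ?_⟩
  rcases eq_or_ne ‖x‖ ‖y‖ with heq | hne
  · calc ‖a • x + b • y‖ ^ p < ‖x‖ ^ p := by
          refine Real.rpow_lt_rpow (norm_nonneg _) ?_ hp₀
          exact norm_combo_lt_of_ne le_rfl heq.ge hxy ha hb hab
      _ = a • ‖x‖ ^ p + b • ‖y‖ ^ p := by rw [← heq, ← add_smul, hab, one_smul]
  · calc ‖a • x + b • y‖ ^ p ≤ (a • ‖x‖ + b • ‖y‖) ^ p := by
          refine Real.rpow_le_rpow (norm_nonneg _) ?_ hp₀.le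
          exact convexOn_univ_norm.2 (Set.mem_univ x) (Set.mem_univ y) ha.le hb.le hab
      _ < a • ‖x‖ ^ p + b • ‖y‖ ^ p :=
        (strictConvexOn_rpow hp).2 (norm_nonneg x) (norm_nonneg y) hne ha hb hab

end Convexity

section Pencils

variable {𝕜 F : Type*} [RCLike 𝕜] [NormedAddCommGroup F]

theorem tendsto_norm_sub_smul_cocompact [NormedSpace 𝕜 F] (x : F) {y : F} (hy : y ≠ 0) :
    Tendsto (fun α : 𝕜 => ‖x - α • y‖) (cocompact 𝕜) atTop := by
  have hlin : Tendsto (fun α : 𝕜 => ‖α‖ * ‖y‖ - ‖x‖) (cocompact 𝕜) atTop :=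
    tendsto_atTop_add_const_right _ _
      (tendsto_norm_cocompact_atTop.atTop_mul_const (norm_pos_iff.mpr hy))
  refine tendsto_atTop_mono (fun α => ?_) hlin
  rw [← norm_smul, norm_sub_rev]
  exact norm_sub_norm_le (α • y) x

theorem tendsto_sum_norm_sub_smul_rpow_cocompact [NormedSpace 𝕜 F] {ι : Type*} [Fintype ι] {p : ℝ}
    (hp : 0 < p) (x : ι → F) {y : ι → F} (hy : ∃ i, y i ≠ 0) :
    Tendsto (fun α : 𝕜 => ∑ i, ‖x i - α • y i‖ ^ p) (cocompact 𝕜) atTop := by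
  obtain ⟨i, hi⟩ := hy
  refine tendsto_atTop_mono (fun α => ?_)
    ((tendsto_rpow_atTop hp).comp (tendsto_norm_sub_smul_cocompact (x i) hi))
  exact single_le_sum (f := fun i => ‖x i - α • y i‖ ^ p) (fun _ _ => by positivity) (mem_univ i)

variable [InnerProductSpace 𝕜 F]

theorem strictConvexOn_norm_sub_smul_rpow {p : ℝ} (hp : 1 < p) (x : F) {y : F} (hy : y ≠ 0) :
    StrictConvexOn ℝ Set.univ fun α : 𝕜 => ‖x - α • y‖ ^ p := by
  let _ : InnerProductSpace ℝ F := InnerProductSpace.rclikeToReal 𝕜 F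
  refine ⟨convex_univ, fun α _ β _ hαβ a b ha hb hab => ?_⟩
  have hne : x - α • y ≠ x - β • y := fun h =>
    hαβ (smul_left_injective 𝕜 hy (sub_right_injective h))
  have hcombo : x - (a • α + b • β) • y = a • (x - α • y) + b • (x - β • y) := by
    rw [smul_sub, smul_sub, add_smul, smul_assoc, smul_assoc, sub_add_sub_comm, ← add_smul, hab,
      one_smul]
  simp only [hcombo]
  exact (strictConvexOn_norm_rpow hp).2 (Set.mem_univ _) (Set.mem_univ _) hne ha hb hab

theorem strictConvexOn_sum_norm_sub_smul_rpow {ι : Type*} [Fintype ι] {p : ℝ} (hp : 1 < p)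
    (x : ι → F) {y : ι → F} (hy : ∃ i, y i ≠ 0) :
    StrictConvexOn ℝ Set.univ fun α : 𝕜 => ∑ i, ‖x i - α • y i‖ ^ p := by
  refine strictConvexOn_sum (fun i => ?_)
    (hy.imp fun i hi => strictConvexOn_norm_sub_smul_rpow hp (x i) hi)
  rcases eq_or_ne (y i) 0 with hi | hi
  · simpa only [hi, smul_zero] using convexOn_const _ convex_univ
  · exact (strictConvexOn_norm_sub_smul_rpow hp (x i) hi).convexOn

end Pencils

theorem exists_apply_ne_zero_of_finrank_lt {ι K V W : Type*} [Fintype ι] [DivisionRing K]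
    [AddCommGroup V] [Module K V] [FiniteDimensional K V] [AddCommGroup W] [Module K W]
    {X : V →ₗ[K] W} (hX : finrank K V < Fintype.card ι + finrank K X.range) {u : ι → V}
    (hu : LinearIndependent K u) : ∃ i, X (u i) ≠ 0 := by
  by_contra! hker
  have hli : LinearIndependent K fun i => (⟨u i, hker i⟩ : X.ker) :=
    LinearIndependent.of_comp X.ker.subtype hu
  have hcard := hli.fintype_card_le_finrank
  have hrank := X.finrank_range_add_finrank_ker
  omega

theorem sum_mul_le_sum_range_of_antitone {n k : ℕ} {a : ℕ → ℝ} (ha : Antitone a)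
    {c : Fin n → ℝ} (hc₀ : ∀ j, 0 ≤ c j) (hc₁ : ∀ j, c j ≤ 1) (hc : ∑ j, c j = k) :
    ∑ j, c j * a j ≤ ∑ j ∈ range k, a j := by
  have hterm (j : Fin n) : c j * (a j - a k) ≤ if (j : ℕ) < k then a j - a k else 0 := by
    split_ifs with h
    · exact mul_le_of_le_one_left (sub_nonneg.mpr (ha h.le)) (hc₁ j)
    · exact mul_nonpos_of_nonneg_of_nonpos (hc₀ j) (sub_nonpos.mpr (ha (not_lt.mp h)))
  have hshift : ∑ j, c j * (a j - a k) ≤ ∑ j ∈ range k, (a j - a k) :=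
    calc ∑ j, c j * (a j - a k) ≤ ∑ j : Fin n, if (j : ℕ) < k then a j - a k else 0 :=
          sum_le_sum fun j _ => hterm j
      _ = ∑ j ∈ range n with j < k, (a j - a k) := by
        rw [Fin.sum_univ_eq_sum_range (fun j => if j < k then a j - a k else 0), sum_filter]
      _ ≤ ∑ j ∈ range k, (a j - a k) :=
        sum_le_sum_of_subset_of_nonneg (fun j hj => mem_range.mpr (mem_filter.mp hj).2)
          fun j hj _ => sub_nonneg.mpr (ha (mem_range.mp hj).le)
  simpa only [mul_sub, sum_sub_distrib, ← sum_mul, hc, sum_const, card_range, nsmul_eq_mul,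
    sub_le_sub_iff_right] using hshift

theorem sq_rpow_half {x : ℝ} (hx : 0 ≤ x) (p : ℝ) : (x ^ 2) ^ (p / 2) = x ^ p := by
  rw [← Real.rpow_natCast_mul hx, Nat.cast_ofNat, mul_div_cancel₀ p two_ne_zero]

section SingularValues

variable {𝕜 E F : Type*} [RCLike 𝕜]
  [NormedAddCommGroup E] [InnerProductSpace 𝕜 E] [FiniteDimensional 𝕜 E]
  [NormedAddCommGroup F] [InnerProductSpace 𝕜 F] [FiniteDimensional 𝕜 F]

/-- An orthonormal basis of right singular vectors of `T`, ordered by decreasing singular value. -/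
noncomputable def rightSingularBasis (T : E →ₗ[𝕜] F) :
    OrthonormalBasis (Fin (finrank 𝕜 E)) 𝕜 E :=
  T.isSymmetric_adjoint_comp_self.eigenvectorBasis rfl

/-- The `p`-th power of the Ky Fan `p`-`k` norm of a linear map. -/
noncomputable def kyFanPowerSum (p : ℝ) (k : ℕ) (T : E →ₗ[𝕜] F) : ℝ :=
  ∑ i ∈ range k, T.singularValues i ^ p

theorem kyFanPowerSum_nonneg (p : ℝ) (k : ℕ) (T : E →ₗ[𝕜] F) : 0 ≤ kyFanPowerSum p k T :=
  sum_nonneg fun i _ => Real.rpow_nonneg (T.singularValues_nonneg i) p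

theorem inner_rightSingularBasis_adjoint_apply (T : E →ₗ[𝕜] F) (j : Fin (finrank 𝕜 E)) (x : E) :
    ⟪rightSingularBasis T j, T.adjoint (T x)⟫_𝕜
      = (T.singularValues j ^ 2 : ℝ) * ⟪rightSingularBasis T j, x⟫_𝕜 := by
  rw [T.sq_singularValues_fin rfl, ← OrthonormalBasis.repr_apply_apply,
    ← OrthonormalBasis.repr_apply_apply]
  exact T.isSymmetric_adjoint_comp_self.eigenvectorBasis_apply_self_apply rfl x j

theorem sq_norm_apply_eq_sum_singularValues (T : E →ₗ[𝕜] F) (x : E) :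
    ‖T x‖ ^ 2 = ∑ j, ‖⟪rightSingularBasis T j, x⟫_𝕜‖ ^ 2 * T.singularValues j ^ 2 := by
  rw [← RCLike.ofReal_inj (K := 𝕜)]
  calc ((‖T x‖ ^ 2 : ℝ) : 𝕜) = ⟪x, T.adjoint (T x)⟫_𝕜 := by
        rw [LinearMap.adjoint_inner_right, inner_self_eq_norm_sq_to_K, RCLike.ofReal_pow]
    _ = ∑ j, ⟪x, rightSingularBasis T j⟫_𝕜 * ⟪rightSingularBasis T j, T.adjoint (T x)⟫_𝕜 :=
      ((rightSingularBasis T).sum_inner_mul_inner _ _).symm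
    _ = _ := by
      rw [RCLike.ofReal_sum]
      refine sum_congr rfl fun j _ => ?_
      rw [inner_rightSingularBasis_adjoint_apply, mul_left_comm, ← inner_conj_symm x,
        RCLike.conj_mul, mul_comm, RCLike.ofReal_mul, RCLike.ofReal_pow ‖_‖]

theorem norm_apply_rightSingularBasis (T : E →ₗ[𝕜] F) (i : Fin (finrank 𝕜 E)) :
    ‖T (rightSingularBasis T i)‖ = T.singularValues i := by
  rw [← sq_eq_sq₀ (norm_nonneg _) (T.singularValues_nonneg i),
    sq_norm_apply_eq_sum_singularValues, sum_eq_single i]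
  · simp
  · intro j _ hj
    simp [(rightSingularBasis T).inner_eq_zero hj]
  · simp

theorem exists_orthonormal_sum_norm_rpow_eq_kyFanPowerSum (p : ℝ) {k : ℕ} (hk : k ≤ finrank 𝕜 E)
    (T : E →ₗ[𝕜] F) :
    ∃ u : Fin k → E, Orthonormal 𝕜 u ∧ ∑ i, ‖T (u i)‖ ^ p = kyFanPowerSum p k T := by
  refine ⟨fun i => rightSingularBasis T (Fin.castLE hk i),
    (rightSingularBasis T).orthonormal.comp _ (Fin.castLE_injective hk), ?_⟩
  simp only [norm_apply_rightSingularBasis, Fin.val_castLE]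
  exact Fin.sum_univ_eq_sum_range (fun i => T.singularValues i ^ p) k

theorem norm_apply_rpow_le_sum_singularValues {p : ℝ} (hp : 2 ≤ p) (T : E →ₗ[𝕜] F) {x : E}
    (hx : ‖x‖ = 1) :
    ‖T x‖ ^ p ≤ ∑ j, ‖⟪rightSingularBasis T j, x⟫_𝕜‖ ^ 2 * T.singularValues j ^ p := by
  have hweights : ∑ j, ‖⟪rightSingularBasis T j, x⟫_𝕜‖ ^ 2 = 1 := by
    rw [(rightSingularBasis T).sum_sq_norm_inner_right, hx, one_pow]
  calc ‖T x‖ ^ p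
      = (∑ j, ‖⟪rightSingularBasis T j, x⟫_𝕜‖ ^ 2 * T.singularValues j ^ 2) ^ (p / 2) := by
        rw [← sq_norm_apply_eq_sum_singularValues, sq_rpow_half (norm_nonneg _)]
    _ ≤ ∑ j, ‖⟪rightSingularBasis T j, x⟫_𝕜‖ ^ 2 * (T.singularValues j ^ 2) ^ (p / 2) :=
      Real.rpow_arith_mean_le_arith_mean_rpow _ _ _ (fun _ _ => by positivity) hweights
        (fun _ _ => by positivity) (by linarith)
    _ = _ := by simp only [sq_rpow_half (T.singularValues_nonneg _)]

theorem sum_norm_rpow_le_kyFanPowerSum {p : ℝ} (hp : 2 ≤ p) {k : ℕ} (T : E →ₗ[𝕜] F)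
    {u : Fin k → E} (hu : Orthonormal 𝕜 u) : ∑ i, ‖T (u i)‖ ^ p ≤ kyFanPowerSum p k T := by
  set v := rightSingularBasis T
  have hanti : Antitone fun j => T.singularValues j ^ p := fun i j hij =>
    Real.rpow_le_rpow (T.singularValues_nonneg j) (T.singularValues_antitone hij) (by linarith)
  have hbessel (j : Fin (finrank 𝕜 E)) : ∑ i, ‖⟪v j, u i⟫_𝕜‖ ^ 2 ≤ 1 := by
    simpa only [norm_inner_symm, v.orthonormal.1 j, one_pow]
      using hu.sum_inner_products_le (v j) (s := univ)
  have htotal : ∑ j, ∑ i, ‖⟪v j, u i⟫_𝕜‖ ^ 2 = k := by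
    rw [sum_comm]
    simp [v.sum_sq_norm_inner_right, hu.1]
  calc ∑ i, ‖T (u i)‖ ^ p ≤ ∑ i, ∑ j, ‖⟪v j, u i⟫_𝕜‖ ^ 2 * T.singularValues j ^ p :=
        sum_le_sum fun i _ => norm_apply_rpow_le_sum_singularValues hp T (hu.1 i)
    _ = ∑ j, (∑ i, ‖⟪v j, u i⟫_𝕜‖ ^ 2) * T.singularValues j ^ p := by
      rw [sum_comm]
      simp only [sum_mul]
    _ ≤ kyFanPowerSum p k T :=
      sum_mul_le_sum_range_of_antitone hanti (fun j => by positivity) hbessel htotal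

theorem strictConvexOn_kyFanPowerSum_sub_smul {p : ℝ} (hp : 2 ≤ p) {k : ℕ}
    (hk : k ≤ finrank 𝕜 E) (A : E →ₗ[𝕜] F) {X : E →ₗ[𝕜] F}
    (hX : finrank 𝕜 E < k + finrank 𝕜 X.range) :
    StrictConvexOn ℝ Set.univ fun α : 𝕜 => kyFanPowerSum p k (A - α • X) := by
  refine strictConvexOn_of_forall_exists_le convex_univ fun α _ => ?_
  obtain ⟨u, hu, hsum⟩ := exists_orthonormal_sum_norm_rpow_eq_kyFanPowerSum p hk (A - α • X)
  exact ⟨fun β => ∑ i, ‖A (u i) - β • X (u i)‖ ^ p,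
    strictConvexOn_sum_norm_sub_smul_rpow (by linarith) _
      (exists_apply_ne_zero_of_finrank_lt (by simpa using hX) hu.linearIndependent),
    fun β _ => sum_norm_rpow_le_kyFanPowerSum hp (A - β • X) hu, hsum⟩

theorem tendsto_kyFanPowerSum_sub_smul_cocompact {p : ℝ} (hp : 2 ≤ p) {k : ℕ}
    (hk : k ≤ finrank 𝕜 E) (A : E →ₗ[𝕜] F) {X : E →ₗ[𝕜] F}
    (hX : finrank 𝕜 E < k + finrank 𝕜 X.range) :
    Tendsto (fun α : 𝕜 => kyFanPowerSum p k (A - α • X)) (cocompact 𝕜) atTop := by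
  obtain ⟨u, hu, -⟩ := exists_orthonormal_sum_norm_rpow_eq_kyFanPowerSum p hk A
  refine tendsto_atTop_mono (fun α => sum_norm_rpow_le_kyFanPowerSum hp (A - α • X) hu)
    (tendsto_sum_norm_sub_smul_rpow_cocompact (by linarith) (fun i => A (u i)) ?_)
  exact exists_apply_ne_zero_of_finrank_lt (by simpa using hX) hu.linearIndependent

theorem mainTheorem3_general {p : ℝ} (hp : 2 ≤ p) {k : ℕ} (hk : k ≤ finrank 𝕜 E)
    (A X : E →ₗ[𝕜] F) (hX : finrank 𝕜 E < k + finrank 𝕜 X.range) :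
    ∃! α₀ : 𝕜, IsLeast (Set.range fun α : 𝕜 => kyFanPowerSum p k (A - α • X) ^ (1 / p))
      (kyFanPowerSum p k (A - α₀ • X) ^ (1 / p)) := by
  have hroot (α β : 𝕜) :
      kyFanPowerSum p k (A - α • X) ^ (1 / p) ≤ kyFanPowerSum p k (A - β • X) ^ (1 / p) ↔
        kyFanPowerSum p k (A - α • X) ≤ kyFanPowerSum p k (A - β • X) :=
    Real.rpow_le_rpow_iff (kyFanPowerSum_nonneg p k _) (kyFanPowerSum_nonneg p k _) (by positivity)
  simp only [IsLeast, Set.mem_range_self, true_and, mem_lowerBounds, Set.forall_mem_range, hroot]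
  exact existsUnique_forall_le_of_strictConvexOn (strictConvexOn_kyFanPowerSum_sub_smul hp hk A hX)
    (tendsto_kyFanPowerSum_sub_smul_cocompact hp hk A hX)

end SingularValues

theorem kyFanNorm_eq_kyFanPowerSum_rpow {m n : ℕ} (p : ℝ) (k : ℕ) (A : Matrix (Fin m) (Fin n) ℂ) :
    kyFanNorm p k A = kyFanPowerSum p k (Matrix.toLpLin 2 2 A) ^ (1 / p) :=
  rfl

theorem rank_eq_finrank_range_toLpLin {m n R : Type*} [Finite m] [Fintype n] [DecidableEq n]
    [CommRing R] (p q : ℝ≥0∞) (X : Matrix m n R) :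
    X.rank = finrank R (Matrix.toLpLin p q X).range := by
  rw [Matrix.toLpLin_eq_toLin]
  exact X.rank_eq_finrank_range_toLin _ _

theorem mainTheorem3 {m n k : ℕ} (hk : 1 ≤ k) (hkmn : k ≤ min m n) (p : ℝ) (hp : 2 ≤ p)
    (A X : Matrix (Fin m) (Fin n) ℂ) (hX : n - k < X.rank) :
    ∃! α₀ : ℂ, IsLeast (Set.range fun α : ℂ => kyFanNorm p k (A - α • X))
      (kyFanNorm p k (A - α₀ • X)) := by
  have hn : finrank ℂ (WithLp 2 (Fin n → ℂ)) = n := finrank_euclideanSpace_fin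
  rw [rank_eq_finrank_range_toLpLin 2 2] at hX
  simp only [kyFanNorm_eq_kyFanPowerSum_rpow, map_sub, map_smul]
  exact mainTheorem3_general hp (by omega) _ _ (by omega)
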